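/- Let $n, m \ge 0$ be integers, let $M_k$ denote the complex $k\times k$ matrices with the operator norm on Euclidean space $\mathbb{C}^k$, and let $T_n \subseteq M_n$ be the subspace of upper triangular matrices. For $k\ge 0$, matrices $[x_{ij}] \in M_k(M_n)$ are normed through the identification $M_k(M_n) \cong M_{kn}$. A linear map $\varphi : T_n \to M_m$ is called completely contractive (respectively completely isometric) if $\|[\varphi(x_{ij})]\| \le \|[x_{ij}]\|$ (respectively $\|[\varphi(x_{ij})]\| = \|[x_{ij}]\|$) for all $k$ and all $[x_{ij}] \in M_k(T_n)$. Then a linear map $\varphi : T_n \to M_m$ is a complete isometry if and only if $n \le m$ and there exist unitary matrices $U, V \in M_m$ and a completely contractive linear map $S : T_n \to M_{m-n}$ such that $$\varphi(A) = U \begin{bmatrix} A & 0 \\ 0 & S(A) \end{bmatrix} V \qquad \text{for all } A \in T_n .$$ -/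

import Mathlib

namespace OpSpace

section

open scoped Matrix.Norms.L2Operator

/-- The norm of a `k × k` matrix `X` over `M_n = M_n(ℂ)`: its entries are flattened to one
complex matrix with rows and columns indexed by `Fin k × Fin n` (the identification
`M_k(M_n) ≅ M_{kn}`), whose operator norm on the Euclidean space is taken. -/
noncomputable def matNorm {k n : ℕ}
    (X : Matrix (Fin k) (Fin k) (Matrix (Fin n) (Fin n) ℂ)) : ℝ :=
  ‖Matrix.comp (Fin k) (Fin k) (Fin n) (Fin n) ℂ X‖

end

/-- A linear map `φ` from a subspace `E` of `M_n` to `M_m` is completely contractive: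
`‖[φ(x_ij)]‖ ≤ ‖[x_ij]‖` for all `k` and all `[x_ij] ∈ M_k(E)`. -/
def IsCompletelyContractive {n m : ℕ} {E : Submodule ℂ (Matrix (Fin n) (Fin n) ℂ)}
    (φ : E →ₗ[ℂ] Matrix (Fin m) (Fin m) ℂ) : Prop :=
  ∀ (k : ℕ) (X : Matrix (Fin k) (Fin k) E),
    matNorm (X.map φ) ≤ matNorm (X.map Subtype.val)

/-- A linear map `φ` from a subspace `E` of `M_n` to `M_m` is completely isometric:
`‖[φ(x_ij)]‖ = ‖[x_ij]‖` for all `k` and all `[x_ij] ∈ M_k(E)`. -/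
def IsCompletelyIsometric {n m : ℕ} {E : Submodule ℂ (Matrix (Fin n) (Fin n) ℂ)}
    (φ : E →ₗ[ℂ] Matrix (Fin m) (Fin m) ℂ) : Prop :=
  ∀ (k : ℕ) (X : Matrix (Fin k) (Fin k) E),
    matNorm (X.map φ) = matNorm (X.map Subtype.val)

/-- The space `T_n` of upper triangular complex `n × n` matrices. -/
def upperTriangular (n : ℕ) : Submodule ℂ (Matrix (Fin n) (Fin n) ℂ) where
  carrier := {A | ∀ i j : Fin n, j < i → A i j = 0}
  zero_mem' := fun _ _ _ => rfl
  add_mem' := fun {A B} hA hB i j h => by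
    rw [Matrix.add_apply, hA i j h, hB i j h, add_zero]
  smul_mem' := fun c A hA i j h => by
    rw [Matrix.smul_apply, hA i j h, smul_zero]

/-- The block diagonal `m × m` matrix `diag{A, B}` with `A ∈ M_n` in the upper left and
`B ∈ M_{m-n}` in the lower right corner, for `n ≤ m`. -/
def blockDiag {n m : ℕ} (h : n ≤ m) (A : Matrix (Fin n) (Fin n) ℂ)
    (B : Matrix (Fin (m - n)) (Fin (m - n)) ℂ) : Matrix (Fin m) (Fin m) ℂ :=
  let e : Fin n ⊕ Fin (m - n) ≃ Fin m :=
    finSumFinEquiv.trans (finCongr (Nat.add_sub_of_le h))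
  Matrix.reindex e e (Matrix.fromBlocks A 0 0 B)

end OpSpace

namespace OpSpace

/-! ### Matrices acting on Euclidean space. -/

open Matrix

/-! The forward direction tests `φ` on the single element `X = [e_ij]`, `i ≤ j`, of `M_n(T_n)`. On
the vectors `e_j ⊗ e_j` it acts as the triangular matrix of ones, so `c = ‖X‖` bounds the norm of
that matrix. As `φ` preserves `c`, some tuple `ξ` attains `c` for `[φ(e_ij)]`. Each `φ(e_ij)` is a
contraction, so the triangle inequality must be an equality in every row, and the numbers `‖ξ_j‖`
are extremal for the matrix of ones, hence positive by a Perron-Frobenius argument. After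
normalising, `φ(e_ij) v_j = w_i` with unit vectors (`IsCompletelyIsometric.exists_unit_vectors`).

From here complete contractivity suffices. Contractive columns and rows of two matrix units give
`φ(e_ij) v_l = 0` for `l ≠ j` and the dual relations for adjoints. So `v` and `w` are orthonormal,
and `φ(A)` maps span `v` to span `w` as `A`, and the orthogonal complement of the first to that of
the second. Extending both families to orthonormal bases gives the unitaries; `S` is the remaining
corner.

Conversely, a direct sum has the maximum of the norms of its summands, and compression recovers `A`.
-/

/-- The action of a complex matrix on Euclidean space. -/
noncomputable def act {p q : ℕ} :
    Matrix (Fin p) (Fin q) ℂ →ₗ[ℂ]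
      (EuclideanSpace ℂ (Fin q) →ₗ[ℂ] EuclideanSpace ℂ (Fin p)) :=
  (Matrix.toEuclideanLin : Matrix (Fin p) (Fin q) ℂ ≃ₗ[ℂ] _).toLinearMap

theorem act_apply {p q : ℕ} (A : Matrix (Fin p) (Fin q) ℂ) (x : EuclideanSpace ℂ (Fin q))
    (i : Fin p) : act A x i = ∑ j, A i j * x j := by
  simp [act, Matrix.toLpLin_apply, Matrix.mulVec, dotProduct]

theorem act_mul {p q r : ℕ} (A : Matrix (Fin p) (Fin q) ℂ) (B : Matrix (Fin q) (Fin r) ℂ)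
    (x : EuclideanSpace ℂ (Fin r)) : act (A * B) x = act A (act B x) := by
  simp [act]

theorem act_one {p : ℕ} (x : EuclideanSpace ℂ (Fin p)) :
    act (1 : Matrix (Fin p) (Fin p) ℂ) x = x := by
  simp [act]

theorem inner_act {p q : ℕ} (A : Matrix (Fin p) (Fin q) ℂ) (x : EuclideanSpace ℂ (Fin q))
    (y : EuclideanSpace ℂ (Fin p)) : inner ℂ (act A x) y = inner ℂ x (act Aᴴ y) := by
  simp only [act, LinearEquiv.coe_coe]
  rw [Matrix.toEuclideanLin_conjTranspose_eq_adjoint, LinearMap.adjoint_inner_right]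

theorem norm_act_of_isometry {p q : ℕ} {Q : Matrix (Fin p) (Fin q) ℂ} (hQ : Qᴴ * Q = 1)
    (x : EuclideanSpace ℂ (Fin q)) : ‖act Q x‖ = ‖x‖ := by
  have h : inner ℂ (act Q x) (act Q x) = inner ℂ x x := by
    rw [inner_act, ← act_mul, hQ, act_one]
  rw [inner_self_eq_norm_sq_to_K, inner_self_eq_norm_sq_to_K] at h
  have h2 : ‖act Q x‖ ^ 2 = ‖x‖ ^ 2 := by exact_mod_cast h
  exact (sq_eq_sq₀ (norm_nonneg _) (norm_nonneg _)).1 h2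

theorem norm_act_conjTranspose_le {p q : ℕ} {Q : Matrix (Fin p) (Fin q) ℂ} (hQ : Qᴴ * Q = 1)
    (y : EuclideanSpace ℂ (Fin p)) : ‖act Qᴴ y‖ ≤ ‖y‖ := by
  have h : (inner ℂ (act Qᴴ y) (act Qᴴ y) : ℂ) = inner ℂ (act Q (act Qᴴ y)) y := by
    rw [inner_act Q]
  have h2 := norm_inner_le_norm (𝕜 := ℂ) (act Q (act Qᴴ y)) y
  rw [← h, norm_act_of_isometry hQ, inner_self_eq_norm_sq_to_K] at h2
  simp only [norm_pow, RCLike.norm_ofReal, abs_norm] at h2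
  rcases (norm_nonneg (act Qᴴ y)).eq_or_lt with h0 | h0
  · rw [← h0]; positivity
  · rw [sq] at h2
    exact le_of_mul_le_mul_left h2 h0

/-! ### Operator norms of matrices over `M_n`, computed on tuples of vectors. -/

section

open scoped Matrix.Norms.L2Operator

/-- The vectors of `ℂ^k ⊗ ℂ^n` as `k`-tuples of vectors of `ℂ^n`. -/
noncomputable def tuple {k n : ℕ} :
    EuclideanSpace ℂ (Fin k × Fin n) ≃ (Fin k → EuclideanSpace ℂ (Fin n)) where
  toFun x i := WithLp.toLp 2 fun p => x (i, p)
  invFun ξ := WithLp.toLp 2 fun ip => ξ ip.1 ip.2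
  left_inv _ := rfl
  right_inv _ := rfl

theorem norm_sq_tuple {k n : ℕ} (x : EuclideanSpace ℂ (Fin k × Fin n)) :
    ‖x‖ ^ 2 = ∑ i, ‖tuple x i‖ ^ 2 := by
  simp only [EuclideanSpace.norm_sq_eq, tuple, Equiv.coe_fn_mk, Fintype.sum_prod_type]

theorem tuple_comp {k n : ℕ} (Y : Matrix (Fin k) (Fin k) (Matrix (Fin n) (Fin n) ℂ))
    (x : EuclideanSpace ℂ (Fin k × Fin n)) (i : Fin k) :
    tuple (Matrix.toEuclideanLin (Matrix.comp (Fin k) (Fin k) (Fin n) (Fin n) ℂ Y) x) i =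
      ∑ j, act (Y i j) (tuple x j) := by
  ext p
  simp [tuple, act_apply, Matrix.toLpLin_apply, Matrix.mulVec, dotProduct,
    Fintype.sum_prod_type]

theorem matNorm_nonneg {k n : ℕ} (Y : Matrix (Fin k) (Fin k) (Matrix (Fin n) (Fin n) ℂ)) :
    0 ≤ matNorm Y := norm_nonneg _

theorem matNorm_le_iff {k n : ℕ} (Y : Matrix (Fin k) (Fin k) (Matrix (Fin n) (Fin n) ℂ))
    {c : ℝ} (hc : 0 ≤ c) :
    matNorm Y ≤ c ↔ ∀ ξ : Fin k → EuclideanSpace ℂ (Fin n),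
      ∑ i, ‖∑ j, act (Y i j) (ξ j)‖ ^ 2 ≤ c ^ 2 * ∑ j, ‖ξ j‖ ^ 2 := by
  rw [matNorm, Matrix.l2_opNorm_def, ContinuousLinearMap.opNorm_le_iff hc,
    ← tuple.forall_congr_right]
  refine forall_congr' fun x => ?_
  rw [← sq_le_sq₀ (norm_nonneg _) (by positivity), mul_pow, norm_sq_tuple, norm_sq_tuple]
  simp [tuple_comp]

theorem sum_norm_sq_le_matNorm {k n : ℕ}
    (Y : Matrix (Fin k) (Fin k) (Matrix (Fin n) (Fin n) ℂ))
    (ξ : Fin k → EuclideanSpace ℂ (Fin n)) :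
    ∑ i, ‖∑ j, act (Y i j) (ξ j)‖ ^ 2 ≤ matNorm Y ^ 2 * ∑ j, ‖ξ j‖ ^ 2 :=
  (matNorm_le_iff Y (matNorm_nonneg Y)).1 le_rfl ξ

theorem matNorm_conjTranspose {k n : ℕ}
    (Y : Matrix (Fin k) (Fin k) (Matrix (Fin n) (Fin n) ℂ)) :
    matNorm (Matrix.of fun i j => (Y j i)ᴴ) = matNorm Y := by
  rw [matNorm, matNorm, ← Matrix.l2_opNorm_conjTranspose]
  congr 1
  ext ⟨i, p⟩ ⟨j, q⟩
  simp [Matrix.comp_apply]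

/-- The unit sphere is compact in finite dimension; `f ≠ 0` ensures that it is nonempty. -/
theorem exists_norm_eq_opNorm_mul {E F : Type*} [NormedAddCommGroup E] [NormedSpace ℂ E]
    [FiniteDimensional ℂ E] [NormedAddCommGroup F] [NormedSpace ℂ F] (f : E →L[ℂ] F)
    (hf : f ≠ 0) : ∃ x, x ≠ 0 ∧ ‖f x‖ = ‖f‖ * ‖x‖ := by
  have : Nontrivial E := by
    by_contra h
    rw [not_nontrivial_iff_subsingleton] at h
    exact hf (ContinuousLinearMap.ext fun x => by rw [Subsingleton.elim x 0]; simp)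
  have : ProperSpace E := FiniteDimensional.proper ℂ E
  let : NormedSpace ℝ E := NormedSpace.restrictScalars ℝ ℂ E
  obtain ⟨x, hx, hmax⟩ := (isCompact_sphere (0 : E) 1).exists_isMaxOn
    (NormedSpace.sphere_nonempty.2 zero_le_one) (f := fun x => ‖f x‖) (by fun_prop)
  have hx1 : ‖x‖ = 1 := by simpa using hx
  refine ⟨x, by rw [← norm_pos_iff, hx1]; exact one_pos, ?_⟩
  rw [hx1, mul_one]
  refine le_antisymm (by simpa [hx1] using f.le_opNorm x) ?_
  refine f.opNorm_le_bound (norm_nonneg _) fun y => ?_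
  rcases eq_or_ne y 0 with rfl | hy
  · simp
  have hy' : ‖y‖ ≠ 0 := norm_ne_zero_iff.2 hy
  have hz : ((‖y‖⁻¹ : ℝ) : ℂ) • y ∈ Metric.sphere (0 : E) 1 := by
    simp [norm_smul, hy']
  have h := hmax hz
  simp only [Set.mem_ofPred_eq, map_smul, norm_smul, Complex.norm_real, norm_inv,
    norm_norm] at h
  rwa [inv_mul_le_iff₀ (by positivity), mul_comm] at h

theorem exists_sum_norm_sq_eq_matNorm {k n : ℕ}
    (Y : Matrix (Fin k) (Fin k) (Matrix (Fin n) (Fin n) ℂ)) (hY : matNorm Y ≠ 0) :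
    ∃ ξ : Fin k → EuclideanSpace ℂ (Fin n), ξ ≠ 0 ∧
      ∑ i, ‖∑ j, act (Y i j) (ξ j)‖ ^ 2 = matNorm Y ^ 2 * ∑ j, ‖ξ j‖ ^ 2 := by
  obtain ⟨x, hx, h⟩ := exists_norm_eq_opNorm_mul
    ((Matrix.toEuclideanLin ≪≫ₗ LinearMap.toContinuousLinearMap)
      (Matrix.comp (Fin k) (Fin k) (Fin n) (Fin n) ℂ Y))
    (by rwa [matNorm, Matrix.l2_opNorm_def, norm_ne_zero_iff] at hY)
  refine ⟨tuple x, fun h0 => hx (tuple.injective (h0.trans ?_)), ?_⟩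
  · ext i p; simp [tuple]
  rw [← Matrix.l2_opNorm_def] at h
  have h2 := congrArg (· ^ 2) h
  simp only [mul_pow, norm_sq_tuple] at h2
  rw [matNorm, ← h2]
  simp [tuple_comp]

end

theorem matNorm_mul_mul_le {k m n : ℕ}
    (Y : Matrix (Fin k) (Fin k) (Matrix (Fin m) (Fin m) ℂ))
    (R : Matrix (Fin n) (Fin m) ℂ) (Q : Matrix (Fin m) (Fin n) ℂ)
    (hR : ∀ x, ‖act R x‖ ≤ ‖x‖) (hQ : ∀ x, ‖act Q x‖ ≤ ‖x‖) :
    matNorm (Y.map fun M => R * M * Q) ≤ matNorm Y := by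
  rw [matNorm_le_iff _ (matNorm_nonneg _)]
  intro ξ
  calc ∑ i, ‖∑ j, act (R * Y i j * Q) (ξ j)‖ ^ 2
      = ∑ i, ‖act R (∑ j, act (Y i j) (act Q (ξ j)))‖ ^ 2 := by
        simp only [act_mul, map_sum]
    _ ≤ ∑ i, ‖∑ j, act (Y i j) (act Q (ξ j))‖ ^ 2 := by gcongr; exact hR _
    _ ≤ matNorm Y ^ 2 * ∑ j, ‖act Q (ξ j)‖ ^ 2 := sum_norm_sq_le_matNorm Y _
    _ ≤ matNorm Y ^ 2 * ∑ j, ‖ξ j‖ ^ 2 := by gcongr; exact hQ _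

/-! ### Columns, rows and matrix units under completely contractive maps. -/

/-- A completely contractive map does not increase the norm of a column. -/
theorem IsCompletelyContractive.column {n m : ℕ}
    {E : Submodule ℂ (Matrix (Fin n) (Fin n) ℂ)} {φ : E →ₗ[ℂ] Matrix (Fin m) (Fin m) ℂ}
    (hφ : IsCompletelyContractive φ) (A B : E)
    (h : ∀ x, ‖act A.1 x‖ ^ 2 + ‖act B.1 x‖ ^ 2 ≤ ‖x‖ ^ 2) (ξ : EuclideanSpace ℂ (Fin m)) :
    ‖act (φ A) ξ‖ ^ 2 + ‖act (φ B) ξ‖ ^ 2 ≤ ‖ξ‖ ^ 2 := by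
  have h1 := hφ 2 !![A, 0; B, 0]
  have h2 : matNorm ((!![A, 0; B, 0] : Matrix (Fin 2) (Fin 2) E).map Subtype.val) ≤ 1 := by
    rw [matNorm_le_iff _ zero_le_one]
    intro x
    have h3 := h (x 0)
    simp only [Fin.sum_univ_two, Matrix.map_apply, Matrix.of_apply, Matrix.cons_val',
      Matrix.cons_val_zero, Matrix.cons_val_one, Matrix.cons_val_fin_one, Submodule.coe_zero,
      map_zero, LinearMap.zero_apply, add_zero]
    nlinarith [sq_nonneg ‖x 1‖]
  have h4 := (matNorm_le_iff _ zero_le_one).1 (h1.trans h2) ![ξ, 0]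
  simpa [Fin.sum_univ_two] using h4

/-- A completely contractive map does not increase the norm of a row. -/
theorem IsCompletelyContractive.row {n m : ℕ}
    {E : Submodule ℂ (Matrix (Fin n) (Fin n) ℂ)} {φ : E →ₗ[ℂ] Matrix (Fin m) (Fin m) ℂ}
    (hφ : IsCompletelyContractive φ) (A B : E)
    (h : ∀ x, ‖act A.1ᴴ x‖ ^ 2 + ‖act B.1ᴴ x‖ ^ 2 ≤ ‖x‖ ^ 2)
    (ξ : EuclideanSpace ℂ (Fin m)) :
    ‖act (φ A)ᴴ ξ‖ ^ 2 + ‖act (φ B)ᴴ ξ‖ ^ 2 ≤ ‖ξ‖ ^ 2 := by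
  have h1 := hφ 2 !![A, B; 0, 0]
  have h2 : matNorm ((!![A, B; 0, 0] : Matrix (Fin 2) (Fin 2) E).map Subtype.val) ≤ 1 := by
    rw [← matNorm_conjTranspose, matNorm_le_iff _ zero_le_one]
    intro x
    have h3 := h (x 0)
    simp only [Fin.sum_univ_two, Matrix.map_apply, Matrix.of_apply, Matrix.cons_val',
      Matrix.cons_val_zero, Matrix.cons_val_one, Matrix.cons_val_fin_one, Submodule.coe_zero,
      map_zero, LinearMap.zero_apply, add_zero, Matrix.conjTranspose_zero]
    nlinarith [sq_nonneg ‖x 1‖]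
  have h5 := h1.trans h2
  rw [← matNorm_conjTranspose] at h5
  have h4 := (matNorm_le_iff _ zero_le_one).1 h5 ![ξ, 0]
  simpa [Fin.sum_univ_two] using h4

/-- The matrix unit `e_ij` of `T_n`, which is zero if `j < i`. -/
noncomputable def triUnit {n : ℕ} (i j : Fin n) : upperTriangular n :=
  if h : i ≤ j then ⟨Matrix.single i j 1, fun k l hlk => by
    rw [Matrix.single_apply, if_neg]
    rintro ⟨rfl, rfl⟩
    exact absurd h (not_le.2 hlk)⟩ else 0

theorem triUnit_coe {n : ℕ} {i j : Fin n} (h : i ≤ j) :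
    (triUnit i j).1 = Matrix.single i j 1 := by
  rw [triUnit, dif_pos h]

theorem triUnit_eq_zero {n : ℕ} {i j : Fin n} (h : ¬ i ≤ j) : triUnit i j = 0 := by
  rw [triUnit, dif_neg h]

theorem eq_sum_triUnit {n : ℕ} (A : upperTriangular n) :
    A = ∑ i, ∑ j, A.1 i j • triUnit i j := by
  apply Subtype.ext
  conv_lhs => rw [Matrix.matrix_eq_sum_single A.1]
  simp only [Submodule.coe_sum, Submodule.coe_smul]
  refine Finset.sum_congr rfl fun i _ => Finset.sum_congr rfl fun j _ => ?_
  by_cases h : i ≤ j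
  · rw [triUnit_coe h, Matrix.smul_single, smul_eq_mul, mul_one]
  · rw [A.2 i j (not_le.1 h), Matrix.single_zero, zero_smul]

theorem act_single {n : ℕ} (i j : Fin n) (x : EuclideanSpace ℂ (Fin n)) :
    act (Matrix.single i j 1) x = EuclideanSpace.single i (x j) := by
  ext p
  rw [act_apply]
  simp only [Matrix.single_apply, PiLp.single_apply]
  rw [Finset.sum_eq_single j]
  · by_cases h : i = p <;> simp [h, eq_comm]
  · intro b _ hb; simp [hb.symm]
  · simp

theorem norm_sq_add_le {n : ℕ} {i j : Fin n} (h : i ≠ j) (x : EuclideanSpace ℂ (Fin n)) :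
    ‖x i‖ ^ 2 + ‖x j‖ ^ 2 ≤ ‖x‖ ^ 2 := by
  rw [EuclideanSpace.norm_sq_eq, ← Finset.sum_pair h (f := fun i => ‖x i‖ ^ 2)]
  exact Finset.sum_le_sum_of_subset_of_nonneg (Finset.subset_univ _) fun _ _ _ => by positivity

theorem norm_sq_apply_le {n : ℕ} (i : Fin n) (x : EuclideanSpace ℂ (Fin n)) :
    ‖x i‖ ^ 2 ≤ ‖x‖ ^ 2 := by
  rw [EuclideanSpace.norm_sq_eq]
  exact Finset.single_le_sum (f := fun i => ‖x i‖ ^ 2) (fun _ _ => by positivity)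
    (Finset.mem_univ i)

section

variable {n m : ℕ} {φ : upperTriangular n →ₗ[ℂ] Matrix (Fin m) (Fin m) ℂ}

theorem IsCompletelyContractive.norm_act_triUnit_le (hφ : IsCompletelyContractive φ)
    (i j : Fin n) (ξ : EuclideanSpace ℂ (Fin m)) : ‖act (φ (triUnit i j)) ξ‖ ≤ ‖ξ‖ := by
  by_cases h : i ≤ j
  · have := hφ.column (triUnit i j) 0 (fun x => by
      simpa [triUnit_coe h, act_single] using norm_sq_apply_le j x) ξ
    exact (sq_le_sq₀ (norm_nonneg _) (norm_nonneg _)).1 (by simpa using this)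
  · simp [triUnit_eq_zero h]

theorem IsCompletelyContractive.norm_act_triUnit_conjTranspose_le
    (hφ : IsCompletelyContractive φ) (i j : Fin n) (ξ : EuclideanSpace ℂ (Fin m)) :
    ‖act (φ (triUnit i j))ᴴ ξ‖ ≤ ‖ξ‖ := by
  by_cases h : i ≤ j
  · have := hφ.row (triUnit i j) 0 (fun x => by
      simpa [triUnit_coe h, act_single, Matrix.conjTranspose_single] using
        norm_sq_apply_le i x) ξ
    exact (sq_le_sq₀ (norm_nonneg _) (norm_nonneg _)).1 (by simpa using this)
  · simp [triUnit_eq_zero h]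

theorem IsCompletelyContractive.column_triUnit (hφ : IsCompletelyContractive φ)
    {i j l : Fin n} (hij : i ≤ j) (hl : l ≠ j) (ξ : EuclideanSpace ℂ (Fin m)) :
    ‖act (φ (triUnit l l)) ξ‖ ^ 2 + ‖act (φ (triUnit i j)) ξ‖ ^ 2 ≤ ‖ξ‖ ^ 2 :=
  hφ.column _ _ (fun x => by
    simpa [triUnit_coe hij, triUnit_coe le_rfl, act_single] using norm_sq_add_le hl x) ξ

theorem IsCompletelyContractive.row_triUnit (hφ : IsCompletelyContractive φ)
    {i j l : Fin n} (hij : i ≤ j) (hl : l ≠ i) (ξ : EuclideanSpace ℂ (Fin m)) :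
    ‖act (φ (triUnit l l))ᴴ ξ‖ ^ 2 + ‖act (φ (triUnit i j))ᴴ ξ‖ ^ 2 ≤ ‖ξ‖ ^ 2 :=
  hφ.row _ _ (fun x => by
    simpa [triUnit_coe hij, triUnit_coe le_rfl, act_single, Matrix.conjTranspose_single] using
      norm_sq_add_le hl x) ξ

end

/-! ### Norm-attaining vectors and the triangular matrix of ones. -/

/-- A nonnegative vector at which the upper triangular matrix of ones attains its norm has
no zero entry. -/
theorem pos_of_sum_Ici_extremal {n : ℕ} {c : ℝ} {x : Fin n → ℝ} (hx : ∀ j, 0 ≤ x j)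
    (hx0 : x ≠ 0)
    (hmax : ∀ z : Fin n → ℝ, ∑ i, (∑ j ∈ Finset.Ici i, z j) ^ 2 ≤ c ^ 2 * ∑ j, z j ^ 2)
    (heq : ∑ i, (∑ j ∈ Finset.Ici i, x j) ^ 2 = c ^ 2 * ∑ j, x j ^ 2) (j : Fin n) :
    0 < x j := by
  refine (hx j).lt_of_ne' fun hj => ?_
  have : NeZero n := ⟨fun h => (h ▸ j).elim0⟩
  set b : Fin n → ℝ := fun i => ∑ l ∈ Finset.Ici i, (Pi.single j 1 : Fin n → ℝ) l with hb
  set y : Fin n → ℝ := fun i => ∑ l ∈ Finset.Ici i, x l with hy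
  have hb0 : ∀ i, 0 ≤ b i := fun i => Finset.sum_nonneg fun l _ => by
    rw [Pi.single_apply]; split_ifs <;> norm_num
  have hy0 : ∀ i, 0 ≤ y i := fun i => Finset.sum_nonneg fun l _ => hx l
  -- Row `0` of the matrix of ones has no zero entry, so `y 0` and `b 0` are both positive.
  have hP : 0 < ∑ i, y i * b i := by
    refine Finset.sum_pos' (fun i _ => mul_nonneg (hy0 i) (hb0 i)) ⟨0, Finset.mem_univ _, ?_⟩
    refine mul_pos ?_ ?_
    · obtain ⟨l, hl⟩ := Function.ne_iff.1 hx0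
      exact Finset.sum_pos' (fun l _ => hx l) ⟨l, by simp, (hx l).lt_of_ne' hl⟩
    · simp [hb]
  set P := ∑ i, y i * b i with hPdef
  -- Perturb `x` by `t` in coordinate `j`. Since `x j = 0`, the right side grows only by `c ^ 2 * t
  -- ^ 2`, while the left side gains the linear term `2 * t * P`: impossible for small `t > 0`.
  have key : ∀ t : ℝ, 2 * t * P + t ^ 2 * ∑ i, b i ^ 2 ≤ c ^ 2 * t ^ 2 := by
    intro t
    have h := hmax fun l => x l + t * (Pi.single j 1 : Fin n → ℝ) l
    have h1 : ∑ l, (x l + t * (Pi.single j 1 : Fin n → ℝ) l) ^ 2 = ∑ l, x l ^ 2 + t ^ 2 := by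
      have : ∀ l, (x l + t * (Pi.single j 1 : Fin n → ℝ) l) ^ 2
          = x l ^ 2 + (Pi.single j (t ^ 2) : Fin n → ℝ) l := by
        intro l
        rcases eq_or_ne l j with rfl | hl
        · simp [hj]
        · simp [hl]
      simp [this, Finset.sum_add_distrib]
    have h2 : ∑ i, (∑ l ∈ Finset.Ici i, (x l + t * (Pi.single j 1 : Fin n → ℝ) l)) ^ 2
        = ∑ i, y i ^ 2 + (2 * t * P + t ^ 2 * ∑ i, b i ^ 2) := by
      rw [hPdef, Finset.mul_sum, Finset.mul_sum, ← Finset.sum_add_distrib,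
        ← Finset.sum_add_distrib]
      refine Finset.sum_congr rfl fun i _ => ?_
      rw [Finset.sum_add_distrib, ← Finset.mul_sum]
      simp only [hy, hb]
      ring
    rw [h1, h2, heq] at h
    linarith
  have hQ : 0 ≤ ∑ i, b i ^ 2 := Finset.sum_nonneg fun _ _ => by positivity
  have h := key (P / (c ^ 2 + 1))
  have hc : 0 < c ^ 2 + 1 := by positivity
  set t := P / (c ^ 2 + 1) with ht
  have ht0 : 0 < t := div_pos hP hc
  have hPt : P = t * (c ^ 2 + 1) := by rw [ht]; field_simp
  have : 0 ≤ t ^ 2 * ∑ i, b i ^ 2 := by positivity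
  rw [hPt] at h
  nlinarith [sq_nonneg c, mul_pos ht0 ht0, mul_nonneg (mul_pos ht0 ht0).le (sq_nonneg c)]

/-- The equality case of the triangle inequality. -/
theorem norm_smul_eq_smul_sum {E ι : Type*} [NormedAddCommGroup E] [InnerProductSpace ℂ E]
    {s : Finset ι} {u : ι → E} {x : ι → ℝ} (hu : ∀ j ∈ s, ‖u j‖ ≤ x j)
    (hs : ‖∑ j ∈ s, u j‖ = ∑ j ∈ s, x j) {j : ι} (hj : j ∈ s) :
    ((‖∑ j ∈ s, u j‖ : ℝ) : ℂ) • u j = ((x j : ℝ) : ℂ) • ∑ j ∈ s, u j := by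
  set η := ∑ j ∈ s, u j with hη
  have h1 : ∀ i ∈ s, RCLike.re (inner ℂ η (u i)) ≤ ‖η‖ * x i := fun i hi =>
    (re_inner_le_norm (𝕜 := ℂ) η (u i)).trans
      (mul_le_mul_of_nonneg_left (hu i hi) (norm_nonneg _))
  -- Pairing the sum with itself makes the termwise Cauchy-Schwarz bounds `h1` add up to an
  -- equality, so each is an equality.
  have h2 : ∑ i ∈ s, RCLike.re (inner ℂ η (u i)) = ∑ i ∈ s, ‖η‖ * x i := by
    rw [← map_sum, ← inner_sum, ← hη, ← Finset.mul_sum, ← hs, inner_self_eq_norm_sq, sq]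
  have h3 := (Finset.sum_eq_sum_iff_of_le h1).1 h2 j hj
  have hxj : 0 ≤ x j := (norm_nonneg _).trans (hu j hj)
  rw [← sub_eq_zero, ← norm_eq_zero, ← sq_eq_zero_iff]
  refine le_antisymm ?_ (sq_nonneg _)
  rw [norm_sub_sq (𝕜 := ℂ), inner_smul_left, inner_smul_right, norm_smul, norm_smul]
  rw [← inner_conj_symm, Complex.conj_ofReal, RCLike.re_to_complex, Complex.re_ofReal_mul,
    Complex.re_ofReal_mul, Complex.conj_re]
  rw [RCLike.re_to_complex] at h3
  rw [h3]
  simp only [Complex.norm_real, Real.norm_eq_abs, mul_pow, sq_abs]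
  have h4 : ‖u j‖ ^ 2 ≤ x j ^ 2 := by gcongr; exact hu j hj
  nlinarith [sq_nonneg ‖η‖, mul_le_mul_of_nonneg_left h4 (sq_nonneg ‖η‖)]

/-- Test `[e_ij]` on `∑ z_j e_j ⊗ e_j`; its image is `∑_i (∑_{j ≥ i} z_j) e_i ⊗ e_i`. -/
theorem sum_Ici_sq_le_matNorm {n : ℕ} (z : Fin n → ℝ) :
    ∑ i, (∑ j ∈ Finset.Ici i, z j) ^ 2 ≤
      matNorm ((Matrix.of triUnit : Matrix (Fin n) (Fin n) (upperTriangular n)).map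
        Subtype.val) ^ 2 * ∑ j, z j ^ 2 := by
  have h := sum_norm_sq_le_matNorm ((Matrix.of triUnit :
    Matrix (Fin n) (Fin n) (upperTriangular n)).map Subtype.val)
    fun j => EuclideanSpace.single j (z j : ℂ)
  have h1 : ∀ i : Fin n, ∑ j, act (triUnit i j).1 (EuclideanSpace.single j (z j : ℂ)) =
      EuclideanSpace.single i ((∑ j ∈ Finset.Ici i, z j : ℝ) : ℂ) := by
    intro i
    rw [← Finset.sum_subset (Finset.subset_univ (Finset.Ici i))]
    · rw [Complex.ofReal_sum]
      ext p
      rw [WithLp.ofLp_sum, Finset.sum_apply, PiLp.single_apply]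
      rw [Finset.sum_congr rfl fun j hj => by
        rw [triUnit_coe (Finset.mem_Ici.1 hj), act_single, PiLp.single_apply,
          PiLp.single_apply, if_pos rfl]]
      split_ifs <;> simp
    · intro j _ hj
      rw [triUnit_eq_zero (by simpa using hj)]
      simp
  simpa [h1, -Complex.ofReal_sum, Complex.norm_real, sq_abs] using h

theorem IsCompletelyIsometric.exists_unit_vectors {n m : ℕ}
    {φ : upperTriangular n →ₗ[ℂ] Matrix (Fin m) (Fin m) ℂ} (hφ : IsCompletelyIsometric φ) :
    ∃ v w : Fin n → EuclideanSpace ℂ (Fin m), (∀ j, ‖v j‖ = 1) ∧ (∀ i, ‖w i‖ = 1) ∧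
      ∀ i j, i ≤ j → act (φ (triUnit i j)) (v j) = w i := by
  rcases Nat.eq_zero_or_pos n with rfl | hn
  · exact ⟨0, 0, fun j => j.elim0, fun j => j.elim0, fun j => j.elim0⟩
  have hcc : IsCompletelyContractive φ := fun k X => (hφ k X).le
  set X : Matrix (Fin n) (Fin n) (upperTriangular n) := Matrix.of triUnit with hX
  have hmax := sum_Ici_sq_le_matNorm (n := n)
  rw [← hX, ← hφ] at hmax
  set c := matNorm (X.map φ) with hc
  have hc0 : c ≠ 0 := by
    intro h0
    have h1 := hmax fun _ => 1
    rw [h0] at h1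
    have h2 := Finset.single_le_sum (f := fun i : Fin n => (∑ j ∈ Finset.Ici i, (1 : ℝ)) ^ 2)
      (fun _ _ => by positivity) (Finset.mem_univ ⟨0, hn⟩)
    have h3 : 0 < (∑ j ∈ Finset.Ici (⟨0, hn⟩ : Fin n), (1 : ℝ)) ^ 2 :=
      pow_pos (Finset.sum_pos (fun _ _ => one_pos) ⟨⟨0, hn⟩, by simp⟩) 2
    simp only [ne_eq, OfNat.ofNat_ne_zero, not_false_eq_true, zero_pow, zero_mul] at h1
    linarith
  obtain ⟨ξ, hξ0, hξ⟩ := exists_sum_norm_sq_eq_matNorm _ hc0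
  have hη : ∀ i, ∑ j, act (X.map φ i j) (ξ j) =
      ∑ j ∈ Finset.Ici i, act (φ (triUnit i j)) (ξ j) := by
    intro i
    rw [← Finset.sum_subset (Finset.subset_univ (Finset.Ici i))]
    · rfl
    · intro j _ hj
      rw [Matrix.map_apply, hX, Matrix.of_apply, triUnit_eq_zero (by simpa using hj)]
      simp
  simp only [hη, ← hc] at hξ
  set η : Fin n → EuclideanSpace ℂ (Fin m) := fun i =>
    ∑ j ∈ Finset.Ici i, act (φ (triUnit i j)) (ξ j) with hηdef
  have hu : ∀ i, ∀ j ∈ Finset.Ici i, ‖act (φ (triUnit i j)) (ξ j)‖ ≤ ‖ξ j‖ :=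
    fun i j _ => hcc.norm_act_triUnit_le i j _
  have hle : ∀ i ∈ Finset.univ, ‖η i‖ ^ 2 ≤ (∑ j ∈ Finset.Ici i, ‖ξ j‖) ^ 2 := fun i _ => by
    gcongr
    exact norm_sum_le_of_le _ (hu i)
  -- The reverse inequality holds because `ξ` attains `c`, while `c` bounds the matrix of ones at
  -- the vector of norms `‖ξ j‖`.
  have hsum : ∑ i, ‖η i‖ ^ 2 = ∑ i, (∑ j ∈ Finset.Ici i, ‖ξ j‖) ^ 2 :=
    le_antisymm (Finset.sum_le_sum hle) (hξ ▸ hmax fun j => ‖ξ j‖)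
  have hnorm : ∀ i, ‖η i‖ = ∑ j ∈ Finset.Ici i, ‖ξ j‖ := fun i =>
    (sq_eq_sq₀ (norm_nonneg _) (Finset.sum_nonneg fun _ _ => norm_nonneg _)).1
      ((Finset.sum_eq_sum_iff_of_le hle).1 hsum i (Finset.mem_univ i))
  have hpos : ∀ j, 0 < ‖ξ j‖ := pos_of_sum_Ici_extremal (fun j => norm_nonneg (ξ j))
    (fun h => hξ0 (funext fun j => norm_eq_zero.1 (congrFun h j))) hmax (hsum ▸ hξ)
  have hηpos : ∀ i, 0 < ‖η i‖ := fun i => by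
    rw [hnorm]
    exact Finset.sum_pos (fun j _ => hpos j) ⟨i, by simp⟩
  have hunit : ∀ x : EuclideanSpace ℂ (Fin m), 0 < ‖x‖ → ‖((‖x‖⁻¹ : ℝ) : ℂ) • x‖ = 1 := by
    intro x hx
    rw [norm_smul, Complex.norm_real, norm_inv, norm_norm, inv_mul_cancel₀ hx.ne']
  refine ⟨fun j => ((‖ξ j‖⁻¹ : ℝ) : ℂ) • ξ j, fun i => ((‖η i‖⁻¹ : ℝ) : ℂ) • η i,
    fun j => hunit _ (hpos j), fun i => hunit _ (hηpos i), fun i j hij => ?_⟩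
  have h := norm_smul_eq_smul_sum (hu i) (hnorm i) (Finset.mem_Ici.2 hij)
  change ((‖η i‖ : ℝ) : ℂ) • _ = ((‖ξ j‖ : ℝ) : ℂ) • η i at h
  have h1 : ((‖ξ j‖ : ℝ) : ℂ) ≠ 0 := Complex.ofReal_ne_zero.2 (hpos j).ne'
  have h2 : ((‖η i‖ : ℝ) : ℂ) ≠ 0 := Complex.ofReal_ne_zero.2 (hηpos i).ne'
  beta_reduce
  rw [map_smul, Complex.ofReal_inv, Complex.ofReal_inv, inv_smul_eq_iff₀ h1, smul_comm,
    eq_inv_smul_iff₀ h2, h]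

/-! ### Orthonormality and intertwining relations. -/

/-- The matrix whose columns are the given vectors. -/
def columns {n m : ℕ} (v : Fin n → EuclideanSpace ℂ (Fin m)) : Matrix (Fin m) (Fin n) ℂ :=
  Matrix.of fun p j => v j p

theorem eq_of_inner_eq_one {E : Type*} [NormedAddCommGroup E] [InnerProductSpace ℂ E]
    {x y : E} (hx : ‖x‖ ≤ 1) (hy : ‖y‖ ≤ 1) (h : inner ℂ x y = (1 : ℂ)) : x = y := by
  rw [← sub_eq_zero, ← norm_eq_zero, ← sq_eq_zero_iff]
  refine le_antisymm ?_ (sq_nonneg _)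
  rw [norm_sub_sq (𝕜 := ℂ), h]
  rw [RCLike.one_re]
  nlinarith [norm_nonneg x, norm_nonneg y]

section

variable {n m : ℕ} {φ : upperTriangular n →ₗ[ℂ] Matrix (Fin m) (Fin m) ℂ}
  {v w : Fin n → EuclideanSpace ℂ (Fin m)}

theorem eq_zero_of_norm_sq_add_le {E F : Type*} [NormedAddCommGroup E] [NormedAddCommGroup F]
    {x : E} {y : F} (h : ‖x‖ ^ 2 + ‖y‖ ^ 2 ≤ 1) (hx : ‖x‖ = 1) : y = 0 := by
  rw [← norm_eq_zero, ← sq_eq_zero_iff]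
  rw [hx] at h
  linarith [sq_nonneg ‖y‖]

/-- The column with entries `e_ll` and `e_ij` is contractive for `l ≠ j`, and `φ(e_ll) v_l = w_l`
already exhausts the norm of `v_l`. -/
theorem IsCompletelyContractive.act_triUnit_of_ne (hφ : IsCompletelyContractive φ)
    (hv : ∀ j, ‖v j‖ = 1) (hw : ∀ i, ‖w i‖ = 1)
    (hvw : ∀ i j, i ≤ j → act (φ (triUnit i j)) (v j) = w i) {i j l : Fin n} (hl : l ≠ j) :
    act (φ (triUnit i j)) (v l) = 0 := by
  by_cases hij : i ≤ j
  · refine eq_zero_of_norm_sq_add_le (x := act (φ (triUnit l l)) (v l)) ?_ ?_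
    · simpa [hv] using hφ.column_triUnit hij hl (v l)
    · rw [hvw l l le_rfl, hw]
  · simp [triUnit_eq_zero hij]

/-- Equality case of Cauchy-Schwarz: the two vectors lie in the unit ball and have inner product
`⟨w_i, w_i⟩ = 1`. -/
theorem IsCompletelyContractive.act_triUnit_conjTranspose
    (hφ : IsCompletelyContractive φ) (hv : ∀ j, ‖v j‖ = 1) (hw : ∀ i, ‖w i‖ = 1)
    (hvw : ∀ i j, i ≤ j → act (φ (triUnit i j)) (v j) = w i) {i j : Fin n} (hij : i ≤ j) :
    act (φ (triUnit i j))ᴴ (w i) = v j := by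
  refine (eq_of_inner_eq_one (hv j).le ?_ ?_).symm
  · exact (hφ.norm_act_triUnit_conjTranspose_le i j _).trans (hw i).le
  · rw [← inner_act, hvw i j hij, inner_self_eq_norm_sq_to_K, hw]
    simp

theorem IsCompletelyContractive.act_triUnit_conjTranspose_of_ne
    (hφ : IsCompletelyContractive φ) (hv : ∀ j, ‖v j‖ = 1) (hw : ∀ i, ‖w i‖ = 1)
    (hvw : ∀ i j, i ≤ j → act (φ (triUnit i j)) (v j) = w i) {i j l : Fin n} (hl : l ≠ i) :
    act (φ (triUnit i j))ᴴ (w l) = 0 := by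
  by_cases hij : i ≤ j
  · refine eq_zero_of_norm_sq_add_le (x := act (φ (triUnit l l))ᴴ (w l)) ?_ ?_
    · simpa [hw] using hφ.row_triUnit hij hl (w l)
    · rw [hφ.act_triUnit_conjTranspose hv hw hvw le_rfl, hv]
  · simp [triUnit_eq_zero hij]

theorem IsCompletelyContractive.orthonormal_source (hφ : IsCompletelyContractive φ)
    (hv : ∀ j, ‖v j‖ = 1) (hw : ∀ i, ‖w i‖ = 1)
    (hvw : ∀ i j, i ≤ j → act (φ (triUnit i j)) (v j) = w i) : Orthonormal ℂ v := by
  refine ⟨hv, fun i j hij => ?_⟩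
  change inner ℂ (v i) (v j) = 0
  rw [← hφ.act_triUnit_conjTranspose hv hw hvw (le_refl j), ← inner_act,
    hφ.act_triUnit_of_ne hv hw hvw hij, inner_zero_left]

theorem IsCompletelyContractive.orthonormal_target (hφ : IsCompletelyContractive φ)
    (hv : ∀ j, ‖v j‖ = 1) (hw : ∀ i, ‖w i‖ = 1)
    (hvw : ∀ i j, i ≤ j → act (φ (triUnit i j)) (v j) = w i) : Orthonormal ℂ w := by
  refine ⟨hw, fun i j hij => ?_⟩
  change inner ℂ (w i) (w j) = 0
  rw [← hvw i i le_rfl, inner_act, hφ.act_triUnit_conjTranspose_of_ne hv hw hvw hij.symm,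
    inner_zero_right]

theorem IsCompletelyContractive.mul_columns (hφ : IsCompletelyContractive φ)
    (hv : ∀ j, ‖v j‖ = 1) (hw : ∀ i, ‖w i‖ = 1)
    (hvw : ∀ i j, i ≤ j → act (φ (triUnit i j)) (v j) = w i) (A : upperTriangular n) :
    φ A * columns v = columns w * A.1 := by
  have h : ∀ j, act (φ A) (v j) = ∑ i, A.1 i j • w i := by
    intro j
    conv_lhs => rw [eq_sum_triUnit A]
    simp only [map_sum, map_smul, LinearMap.sum_apply, LinearMap.smul_apply]
    refine Finset.sum_congr rfl fun i _ => ?_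
    rw [Finset.sum_eq_single j]
    · by_cases hij : i ≤ j
      · rw [hvw i j hij]
      · rw [A.2 i j (not_le.1 hij), zero_smul, zero_smul]
    · intro l _ hl
      rw [hφ.act_triUnit_of_ne hv hw hvw hl.symm, smul_zero]
    · simp
  ext p j
  have := congrArg (fun x : EuclideanSpace ℂ (Fin m) => x p) (h j)
  simpa [act_apply, columns, Matrix.mul_apply, mul_comm] using this

/-- The adjoint counterpart of `mul_columns`; together they make both off-diagonal blocks of `φ A`
vanish. -/
theorem IsCompletelyContractive.columns_conjTranspose_mul (hφ : IsCompletelyContractive φ)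
    (hv : ∀ j, ‖v j‖ = 1) (hw : ∀ i, ‖w i‖ = 1)
    (hvw : ∀ i j, i ≤ j → act (φ (triUnit i j)) (v j) = w i) (A : upperTriangular n) :
    (columns w)ᴴ * φ A = A.1 * (columns v)ᴴ := by
  have h : ∀ i, act (φ A)ᴴ (w i) = ∑ j, star (A.1 i j) • v j := by
    intro i
    conv_lhs => rw [eq_sum_triUnit A]
    simp only [map_sum, map_smul, LinearMap.sum_apply, LinearMap.smul_apply,
      Matrix.conjTranspose_sum, Matrix.conjTranspose_smul]
    rw [Finset.sum_comm]
    refine Finset.sum_congr rfl fun j _ => ?_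
    rw [Finset.sum_eq_single i]
    · by_cases hij : i ≤ j
      · rw [hφ.act_triUnit_conjTranspose hv hw hvw hij]
      · rw [A.2 i j (not_le.1 hij), star_zero, zero_smul, zero_smul]
    · intro l _ hl
      rw [hφ.act_triUnit_conjTranspose_of_ne hv hw hvw hl.symm, smul_zero]
    · simp
  rw [← Matrix.conjTranspose_inj]
  ext p i
  have := congrArg (fun x : EuclideanSpace ℂ (Fin m) => x p) (h i)
  simpa [act_apply, columns, Matrix.mul_apply, mul_comm] using this

end

/-! ### Block decompositions and extension to unitaries. -/

/-- The splitting of `Fin m` into the first `n` and the last `m - n` indices. -/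
def splitEquiv {n m : ℕ} (h : n ≤ m) : Fin n ⊕ Fin (m - n) ≃ Fin m :=
  finSumFinEquiv.trans (finCongr (Nat.add_sub_of_le h))

/-- The coordinate matrix `ℂ^r → ℂ^m` sending the `q`-th basis vector to the `f q`-th one. -/
def coordMatrix {r m : ℕ} (f : Fin r → Fin m) : Matrix (Fin m) (Fin r) ℂ :=
  (1 : Matrix (Fin m) (Fin m) ℂ).submatrix id f

theorem mul_coordMatrix {r s m : ℕ} (M : Matrix (Fin s) (Fin m) ℂ) (f : Fin r → Fin m) :
    M * coordMatrix f = M.submatrix id f := by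
  conv_rhs => rw [← Matrix.mul_one M, Matrix.submatrix_mul _ _ id id f Function.bijective_id]
  rfl

theorem coordMatrix_conjTranspose_mul {r s m : ℕ} (M : Matrix (Fin m) (Fin s) ℂ)
    (f : Fin r → Fin m) : (coordMatrix f)ᴴ * M = M.submatrix f id := by
  conv_rhs => rw [← Matrix.one_mul M, Matrix.submatrix_mul _ _ f id id Function.bijective_id]
  rw [coordMatrix, Matrix.conjTranspose_submatrix, Matrix.conjTranspose_one,
    Matrix.submatrix_id_id]

theorem coordMatrix_isometry {r m : ℕ} {f : Fin r → Fin m} (hf : Function.Injective f) :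
    (coordMatrix f)ᴴ * coordMatrix f = 1 := by
  rw [coordMatrix_conjTranspose_mul, coordMatrix, Matrix.submatrix_submatrix]
  exact Matrix.submatrix_one f hf

section

variable {n m : ℕ} (h : n ≤ m)

theorem splitEquiv_inl_injective : Function.Injective (splitEquiv h ∘ Sum.inl) :=
  (splitEquiv h).injective.comp Sum.inl_injective

theorem splitEquiv_inr_injective : Function.Injective (splitEquiv h ∘ Sum.inr) :=
  (splitEquiv h).injective.comp Sum.inr_injective

theorem blockDiag_submatrix (A : Matrix (Fin n) (Fin n) ℂ)
    (B : Matrix (Fin (m - n)) (Fin (m - n)) ℂ) :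
    (blockDiag h A B).submatrix (splitEquiv h) (splitEquiv h) =
      Matrix.fromBlocks A 0 0 B := by
  ext i j
  simp [blockDiag, splitEquiv]

theorem norm_sq_split (x : EuclideanSpace ℂ (Fin m)) :
    ‖x‖ ^ 2 = ‖act (coordMatrix (splitEquiv h ∘ Sum.inl))ᴴ x‖ ^ 2 +
      ‖act (coordMatrix (splitEquiv h ∘ Sum.inr))ᴴ x‖ ^ 2 := by
  simp only [EuclideanSpace.norm_sq_eq]
  rw [← (splitEquiv h).sum_comp, Fintype.sum_sum_type]
  simp [act_apply, coordMatrix, Matrix.one_apply]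

theorem blockDiag_inl (A : Matrix (Fin n) (Fin n) ℂ)
    (B : Matrix (Fin (m - n)) (Fin (m - n)) ℂ) :
    (coordMatrix (splitEquiv h ∘ Sum.inl))ᴴ * blockDiag h A B =
      A * (coordMatrix (splitEquiv h ∘ Sum.inl))ᴴ := by
  rw [coordMatrix_conjTranspose_mul]
  ext p q
  obtain ⟨q, rfl⟩ := (splitEquiv h).surjective q
  have := congrFun (congrFun (blockDiag_submatrix h A B) (Sum.inl p)) q
  rw [Matrix.submatrix_apply] at this
  simp only [Matrix.submatrix_apply, Function.comp_apply, id, this]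
  cases q <;> simp [coordMatrix, Matrix.mul_apply, Matrix.one_apply, eq_comm]

theorem blockDiag_inr (A : Matrix (Fin n) (Fin n) ℂ)
    (B : Matrix (Fin (m - n)) (Fin (m - n)) ℂ) :
    (coordMatrix (splitEquiv h ∘ Sum.inr))ᴴ * blockDiag h A B =
      B * (coordMatrix (splitEquiv h ∘ Sum.inr))ᴴ := by
  rw [coordMatrix_conjTranspose_mul]
  ext p q
  obtain ⟨q, rfl⟩ := (splitEquiv h).surjective q
  have := congrFun (congrFun (blockDiag_submatrix h A B) (Sum.inr p)) q
  rw [Matrix.submatrix_apply] at this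
  simp only [Matrix.submatrix_apply, Function.comp_apply, id, this]
  cases q <;> simp [coordMatrix, Matrix.mul_apply, Matrix.one_apply, eq_comm]

theorem eq_blockDiag_of_submatrix {D : Matrix (Fin m) (Fin m) ℂ}
    {A : Matrix (Fin n) (Fin n) ℂ}
    (h11 : D.submatrix (splitEquiv h ∘ Sum.inl) (splitEquiv h ∘ Sum.inl) = A)
    (h12 : D.submatrix (splitEquiv h ∘ Sum.inl) (splitEquiv h ∘ Sum.inr) = 0)
    (h21 : D.submatrix (splitEquiv h ∘ Sum.inr) (splitEquiv h ∘ Sum.inl) = 0) :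
    D = blockDiag h A (D.submatrix (splitEquiv h ∘ Sum.inr) (splitEquiv h ∘ Sum.inr)) := by
  have hD : D.submatrix (splitEquiv h) (splitEquiv h) =
      (blockDiag h A (D.submatrix (splitEquiv h ∘ Sum.inr)
        (splitEquiv h ∘ Sum.inr))).submatrix (splitEquiv h) (splitEquiv h) := by
    rw [blockDiag_submatrix, ← h11]
    ext (i | i) (j | j)
    · simp
    · simpa using congrFun (congrFun h12 i) j
    · simpa using congrFun (congrFun h21 i) j
    · simp
  ext i j
  obtain ⟨i, rfl⟩ := (splitEquiv h).surjective i
  obtain ⟨j, rfl⟩ := (splitEquiv h).surjective j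
  exact congrFun (congrFun hD i) j

/-- By `norm_sq_split` the squared norms of the two orthogonal components add, and each block acts
on its own component. -/
theorem matNorm_blockDiag_le {k : ℕ}
    (X : Matrix (Fin k) (Fin k) (Matrix (Fin n) (Fin n) ℂ))
    (Y : Matrix (Fin k) (Fin k) (Matrix (Fin (m - n)) (Fin (m - n)) ℂ)) {c : ℝ} (hc : 0 ≤ c)
    (hX : matNorm X ≤ c) (hY : matNorm Y ≤ c) :
    matNorm (Matrix.of fun i j => blockDiag h (X i j) (Y i j)) ≤ c := by
  rw [matNorm_le_iff _ hc] at hX hY ⊢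
  intro ξ
  have h1 := hX fun j => act (coordMatrix (splitEquiv h ∘ Sum.inl))ᴴ (ξ j)
  have h2 := hY fun j => act (coordMatrix (splitEquiv h ∘ Sum.inr))ᴴ (ξ j)
  simp only [Matrix.of_apply, norm_sq_split h (∑ j, _), norm_sq_split h (ξ _), map_sum,
    ← act_mul, blockDiag_inl, blockDiag_inr, Finset.sum_add_distrib, mul_add]
  simp only [← act_mul] at h1 h2
  exact add_le_add h1 h2

theorem exists_unitary_of_orthonormal {v : Fin n → EuclideanSpace ℂ (Fin m)}
    (hv : Orthonormal ℂ v) : ∃ U : Matrix.unitaryGroup (Fin m) ℂ,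
      (U : Matrix (Fin m) (Fin m) ℂ).submatrix id (splitEquiv h ∘ Sum.inl) = columns v := by
  have ho : Orthonormal ℂ ((Set.range (Sum.inl : Fin n → Fin n ⊕ Fin (m - n))).domRestrict
      (Sum.elim v 0)) := by
    convert hv.comp (Equiv.ofInjective _ (Sum.inl_injective (β := Fin (m - n)))).symm
      (Equiv.injective _) using 1
    ext1 ⟨_, i, rfl⟩
    simp [Set.domRestrict]
  obtain ⟨b, hb⟩ := ho.exists_orthonormalBasis_extension_of_card_eq (by simp [h])
  refine ⟨⟨_, (EuclideanSpace.basisFun (Fin m) ℂ).toMatrix_orthonormalBasis_mem_unitary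
    (b.reindex (splitEquiv h))⟩, ?_⟩
  ext p j
  have hj : b (Sum.inl j) = v j := hb _ ⟨j, rfl⟩
  simp [columns, Module.Basis.toMatrix_apply, hj]

end

/-! ### The two implications. -/

theorem unitary_conjTranspose_mul {m : ℕ} (U : Matrix.unitaryGroup (Fin m) ℂ) :
    (U : Matrix (Fin m) (Fin m) ℂ)ᴴ * U = 1 := Matrix.UnitaryGroup.star_mul_self U

theorem unitary_mul_conjTranspose {m : ℕ} (U : Matrix.unitaryGroup (Fin m) ℂ) :
    (U : Matrix (Fin m) (Fin m) ℂ) * (U : Matrix (Fin m) (Fin m) ℂ)ᴴ = 1 :=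
  Matrix.mem_unitaryGroup_iff.1 U.2

theorem IsCompletelyIsometric.exists_blockDiag {n m : ℕ}
    {φ : upperTriangular n →ₗ[ℂ] Matrix (Fin m) (Fin m) ℂ} (hφ : IsCompletelyIsometric φ) :
    ∃ (h : n ≤ m) (U V : Matrix.unitaryGroup (Fin m) ℂ)
      (S : upperTriangular n →ₗ[ℂ] Matrix (Fin (m - n)) (Fin (m - n)) ℂ),
      IsCompletelyContractive S ∧ ∀ A : upperTriangular n,
        φ A = (U : Matrix (Fin m) (Fin m) ℂ) * blockDiag h A.1 (S A) * V := by
  have hcc : IsCompletelyContractive φ := fun k X => (hφ k X).le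
  obtain ⟨v, w, hv, hw, hvw⟩ := hφ.exists_unit_vectors
  have hov := hcc.orthonormal_source hv hw hvw
  have how := hcc.orthonormal_target hv hw hvw
  have h : n ≤ m := by simpa using hov.linearIndependent.fintype_card_le_finrank
  obtain ⟨B, hB⟩ := exists_unitary_of_orthonormal h hov
  obtain ⟨U, hU⟩ := exists_unitary_of_orthonormal h how
  set J₁ := coordMatrix (splitEquiv h ∘ Sum.inl) with hJ₁
  set J₂ := coordMatrix (splitEquiv h ∘ Sum.inr) with hJ₂
  rw [← mul_coordMatrix, ← hJ₁] at hB hU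
  have hJ11 : J₁ᴴ * J₁ = 1 := coordMatrix_isometry (splitEquiv_inl_injective h)
  have hJ22 : J₂ᴴ * J₂ = 1 := coordMatrix_isometry (splitEquiv_inr_injective h)
  have hJ12 : J₁ᴴ * J₂ = 0 := by
    rw [hJ₁, coordMatrix_conjTranspose_mul]
    ext p q
    simp [hJ₂, coordMatrix]
  have hJ21 : J₂ᴴ * J₁ = 0 := by
    rw [← Matrix.conjTranspose_inj, Matrix.conjTranspose_mul, Matrix.conjTranspose_conjTranspose,
      hJ12, Matrix.conjTranspose_zero]
  have hB1 := unitary_conjTranspose_mul B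
  have hU1 := unitary_conjTranspose_mul U
  have hcol : ∀ A, φ A * (B.1 * J₁) = U.1 * J₁ * A.1 := fun A => by
    rw [hB, hU, hcc.mul_columns hv hw hvw]
  have hrow : ∀ A, J₁ᴴ * (U.1ᴴ * φ A) = A.1 * (J₁ᴴ * B.1ᴴ) := fun A => by
    rw [← Matrix.mul_assoc, ← Matrix.conjTranspose_mul, ← Matrix.conjTranspose_mul, hB, hU,
      hcc.columns_conjTranspose_mul hv hw hvw]
  have hsub : ∀ {r s : ℕ} (f : Fin r → Fin m) (g : Fin s → Fin m)
      (M : Matrix (Fin m) (Fin m) ℂ), M.submatrix f g = (coordMatrix f)ᴴ * M * coordMatrix g :=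
    fun f g M => by
      rw [coordMatrix_conjTranspose_mul, mul_coordMatrix, Matrix.submatrix_submatrix]
      rfl
  -- The lower right corner of `Uᴴ * φ A * B`, where `B` and `U` begin with the columns `v` and `w`.
  -- As a two-sided compression of `φ` it is completely contractive.
  let S : upperTriangular n →ₗ[ℂ] Matrix (Fin (m - n)) (Fin (m - n)) ℂ :=
    { toFun := fun A => (J₂ᴴ * U.1ᴴ) * φ A * (B.1 * J₂)
      map_add' := fun A A' => by rw [map_add, Matrix.mul_add, Matrix.add_mul]
      map_smul' := fun c A => by
        rw [map_smul, Matrix.mul_smul, Matrix.smul_mul, RingHom.id_apply] }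
  refine ⟨h, U, star B, S, fun k X => ?_, fun A => ?_⟩
  · have hUJ : (U.1 * J₂)ᴴ * (U.1 * J₂) = 1 := by
      rw [Matrix.conjTranspose_mul, Matrix.mul_assoc, ← Matrix.mul_assoc _ U.1, hU1,
        Matrix.one_mul, hJ22]
    have hBJ : (B.1 * J₂)ᴴ * (B.1 * J₂) = 1 := by
      rw [Matrix.conjTranspose_mul, Matrix.mul_assoc, ← Matrix.mul_assoc _ B.1, hB1,
        Matrix.one_mul, hJ22]
    refine le_trans ?_ (hcc k X)
    refine matNorm_mul_mul_le (X.map φ) (J₂ᴴ * U.1ᴴ) (B.1 * J₂) (fun x => ?_)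
      fun x => (norm_act_of_isometry hBJ x).le
    rw [← Matrix.conjTranspose_mul]
    exact norm_act_conjTranspose_le hUJ x
  · have hD : U.1ᴴ * φ A * B.1 = blockDiag h A.1 (S A) := by
      have := eq_blockDiag_of_submatrix h (D := U.1ᴴ * φ A * B.1) (A := A.1) ?_ ?_ ?_
      · rw [this]
        congr 1
        rw [hsub, ← hJ₂]
        simp only [S, LinearMap.coe_mk, AddHom.coe_mk, Matrix.mul_assoc]
      · rw [hsub, ← hJ₁, Matrix.mul_assoc, Matrix.mul_assoc, Matrix.mul_assoc, hcol,
          Matrix.mul_assoc, ← Matrix.mul_assoc _ U.1, hU1, Matrix.one_mul, ← Matrix.mul_assoc,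
          hJ11, Matrix.one_mul]
      · rw [hsub, ← hJ₁, ← hJ₂, ← Matrix.mul_assoc, hrow, Matrix.mul_assoc, Matrix.mul_assoc,
          Matrix.mul_assoc, ← Matrix.mul_assoc _ B.1, hB1, Matrix.one_mul, hJ12, Matrix.mul_zero]
      · rw [hsub, ← hJ₁, ← hJ₂, Matrix.mul_assoc, Matrix.mul_assoc, Matrix.mul_assoc, hcol,
          Matrix.mul_assoc, ← Matrix.mul_assoc _ U.1, hU1, Matrix.one_mul, ← Matrix.mul_assoc,
          hJ21, Matrix.zero_mul]
    rw [← hD]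
    change φ A = U.1 * (U.1ᴴ * φ A * B.1) * B.1ᴴ
    rw [Matrix.mul_assoc, Matrix.mul_assoc, unitary_mul_conjTranspose, Matrix.mul_one,
      ← Matrix.mul_assoc, unitary_mul_conjTranspose, Matrix.one_mul]

theorem isCompletelyIsometric_of_blockDiag {n m : ℕ}
    {φ : upperTriangular n →ₗ[ℂ] Matrix (Fin m) (Fin m) ℂ} (h : n ≤ m)
    (U V : Matrix.unitaryGroup (Fin m) ℂ)
    {S : upperTriangular n →ₗ[ℂ] Matrix (Fin (m - n)) (Fin (m - n)) ℂ}
    (hS : IsCompletelyContractive S)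
    (hφ : ∀ A : upperTriangular n,
      φ A = (U : Matrix (Fin m) (Fin m) ℂ) * blockDiag h A.1 (S A) * V) :
    IsCompletelyIsometric φ := by
  intro k X
  have hU := unitary_conjTranspose_mul U
  have hV := unitary_conjTranspose_mul V
  have hV' := unitary_mul_conjTranspose V
  have hVV : V.1ᴴᴴ * V.1ᴴ = 1 := by rwa [Matrix.conjTranspose_conjTranspose]
  refine le_antisymm ?_ ?_
  · refine le_trans ?_ (matNorm_blockDiag_le h (X.map Subtype.val) (X.map S) (matNorm_nonneg _)
      le_rfl (hS k X))
    refine le_of_eq_of_le ?_ (matNorm_mul_mul_le _ U.1 V.1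
      (fun x => (norm_act_of_isometry hU x).le) fun x => (norm_act_of_isometry hV x).le)
    congr 1
    ext1 i j
    exact hφ _
  · set J := coordMatrix (splitEquiv h ∘ Sum.inl) with hJ
    have hJJ : Jᴴ * J = 1 := coordMatrix_isometry (splitEquiv_inl_injective h)
    -- Undo the unitaries and compress to the upper left corner, so that `A` is obtained from `φ A`
    -- by multiplication with contractions.
    have key : ∀ A, A.1 = (Jᴴ * U.1ᴴ) * φ A * (V.1ᴴ * J) := fun A => by
      rw [hφ]
      calc A.1 = Jᴴ * blockDiag h A.1 (S A) * J := by
            rw [blockDiag_inl, Matrix.mul_assoc, hJJ, Matrix.mul_one]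
        _ = Jᴴ * ((U.1ᴴ * U.1) * blockDiag h A.1 (S A) * (V.1 * V.1ᴴ)) * J := by
            rw [hU, hV', Matrix.one_mul, Matrix.mul_one]
        _ = _ := by simp only [Matrix.mul_assoc]
    refine le_of_eq_of_le ?_ (matNorm_mul_mul_le (X.map φ) (Jᴴ * U.1ᴴ) (V.1ᴴ * J)
      (fun x => ?_) fun x => ?_)
    · congr 1
      ext1 i j
      exact key _
    · rw [act_mul]
      exact (norm_act_conjTranspose_le hJJ _).trans (norm_act_conjTranspose_le hU x)
    · rw [act_mul, norm_act_of_isometry hVV, norm_act_of_isometry hJJ]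

end OpSpace

theorem corollary2p5 (n m : ℕ)
    (φ : OpSpace.upperTriangular n →ₗ[ℂ] Matrix (Fin m) (Fin m) ℂ) :
    OpSpace.IsCompletelyIsometric φ ↔
      ∃ (h : n ≤ m) (U V : Matrix.unitaryGroup (Fin m) ℂ)
        (S : OpSpace.upperTriangular n →ₗ[ℂ] Matrix (Fin (m - n)) (Fin (m - n)) ℂ),
        OpSpace.IsCompletelyContractive S ∧
        ∀ A : OpSpace.upperTriangular n,
          φ A = (U : Matrix (Fin m) (Fin m) ℂ) *
            OpSpace.blockDiag h (A : Matrix (Fin n) (Fin n) ℂ) (S A) *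
            (V : Matrix (Fin m) (Fin m) ℂ) :=
  ⟨fun hφ => hφ.exists_blockDiag, fun ⟨h, U, V, _, hS, hφ⟩ =>
    OpSpace.isCompletelyIsometric_of_blockDiag h U V hS hφ⟩
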